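/- Let $\lambda>0$, $c>0$ and $0<p<1$. A particle starts at the origin of the plane at time $0$ and moves with constant speed $c$ along one of the four directions $d_j=(\cos\frac{\pi j}{2},\sin\frac{\pi j}{2})$, $j\in\mathbb{Z}/4\mathbb{Z}$. The initial direction is chosen uniformly among the four. The direction switches occur at the events of a homogeneous Poisson process of intensity $\lambda$ that is independent of the sequence of successive directions, which is a Markov chain with the following rule: if the particle is moving horizontally ($j\in\{0,2\}$), the switch leads from $d_j$ to $d_{j+1}$ (counterclockwise turn) with probability $p$ and to $d_{j-1}$ (clockwise turn) with probability $1-p$; if it is moving vertically ($j\in\{1,3\}$), the switch leads from $d_j$ to $d_{j+1}$ with probability $1-p$ and to $d_{j-1}$ with probability $p$. Let $(X(t),Y(t))$ be the position of the particle at time $t$. Then, for all $t\ge 0$ and $\alpha,\beta\in\mathbb{R}$, $$\mathbb{E}\left[e^{i\alpha X(t)+i\beta Y(t)}\right]=\frac{e^{-\lambda t}}{4}\left\{\left(1+\frac{\lambda p}{A}\right)e^{At}+\left(1-\frac{\lambda p}{A}\right)e^{-At}\right\}\left\{\left(1+\frac{\lambda(1-p)}{B}\right)e^{Bt}+\left(1-\frac{\lambda(1-p)}{B}\right)e^{-Bt}\right\},$$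 where $$A=A(\alpha,\beta)=\tfrac12\sqrt{4\lambda^2p^2-c^2(\alpha-\beta)^2},\qquad B=B(\alpha,\beta)=\tfrac12\sqrt{4\lambda^2(1-p)^2-c^2(\alpha+\beta)^2}$$ are complex square roots (purely imaginary when the radicand is negative). If $A=0$, the first factor in braces is understood as its limit $2(1+\lambda pt)$ as $A\to0$; if $B=0$, the second is understood as its limit $2(1+\lambda(1-p)t)$ as $B\to0$. -/

import Mathlib

open MeasureTheory ProbabilityTheory
open scoped NNReal

noncomputable section

/-- `N` is a homogeneous Poisson process with intensity `lam` on `(Ω, P)`: it starts from `0`, has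
independent Poisson increments, and almost surely has nondecreasing, right-continuous paths. -/
structure IsPoissonProcess {Ω : Type*} [MeasurableSpace Ω] (lam : ℝ≥0) (N : ℝ≥0 → Ω → ℕ)
    (P : Measure Ω) : Prop where
  measurable : ∀ t, Measurable (N t)
  zero : ∀ᵐ ω ∂P, N 0 ω = 0
  increment : ∀ s t : ℝ≥0, s ≤ t →
    HasLaw (fun ω => N t ω - N s ω) (poissonMeasure (lam * (t - s))) P
  indep : HasIndepIncrements N P
  monotone : ∀ᵐ ω ∂P, Monotone (fun t => N t ω)
  rightContinuous : ∀ᵐ ω ∂P, ∀ t, ContinuousWithinAt (fun s => N s ω) (Set.Ici t) t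

/-- The direction with index `j` is `d_j = (cos (π j / 2), sin (π j / 2))`, where `j` is taken
modulo `4`. This is its first coordinate. -/
def dirX (j : ZMod 4) : ℝ := Real.cos (Real.pi * (j.val : ℝ) / 2)

/-- The second coordinate of the direction `d_j = (cos (π j / 2), sin (π j / 2))`. -/
def dirY (j : ZMod 4) : ℝ := Real.sin (Real.pi * (j.val : ℝ) / 2)

/-- The probability that a switch turns direction `d_i` into direction `d_j`. From a horizontal
direction (`i = 0, 2`) the turn is counterclockwise (`j = i + 1`) with probability `p` and
clockwise (`j = i - 1`) with probability `1 - p`; from a vertical direction (`i = 1, 3`) it is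
counterclockwise with probability `1 - p` and clockwise with probability `p`. -/
def turnProb (p : ℝ) (i j : ZMod 4) : ℝ :=
  if j = i + 1 then (if i = 0 ∨ i = 2 then p else 1 - p)
  else if j = i - 1 then (if i = 0 ∨ i = 2 then 1 - p else p)
  else 0

/-- `J n` is the (index of the) direction after `n` switches: a Markov chain whose initial state is
uniform on the four directions and whose transition probabilities are `turnProb p`. -/
structure IsDirectionChain {Ω : Type*} [MeasurableSpace Ω] (p : ℝ) (J : ℕ → Ω → ZMod 4)
    (P : Measure Ω) : Prop where
  measurable : ∀ n, Measurable (J n)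
  path_prob : ∀ (n : ℕ) (i : ℕ → ZMod 4),
    P.real {ω | ∀ k ≤ n, J k ω = i k} =
      1 / 4 * ∏ k ∈ Finset.range n, turnProb p (i k) (i (k + 1))

/-- The data of the planar motion: a Poisson process `N` with intensity `lam` which counts the
direction switches, and, independent of it, the chain `J` of the successive directions. -/
structure IsOrthogonalMotion {Ω : Type*} [MeasurableSpace Ω] (lam : ℝ≥0) (p : ℝ)
    (N : ℝ≥0 → Ω → ℕ) (J : ℕ → Ω → ZMod 4) (P : Measure Ω) : Prop where
  poisson : IsPoissonProcess lam N P
  chain : IsDirectionChain p J P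
  indep : IndepFun (fun ω t => N t ω) (fun ω n => J n ω) P

/-- The (index of the) direction `D(t)` at time `t`. -/
def direction {Ω : Type*} (N : ℝ≥0 → Ω → ℕ) (J : ℕ → Ω → ZMod 4) (t : ℝ≥0) (ω : Ω) : ZMod 4 :=
  J (N t ω) ω

/-- The abscissa `X(t)` of the particle that starts from the origin and moves with constant speed
`c` in the direction `D(s)` at each time `s`. -/
def posX {Ω : Type*} (c : ℝ) (N : ℝ≥0 → Ω → ℕ) (J : ℕ → Ω → ZMod 4) (t : ℝ≥0) (ω : Ω) : ℝ :=
  c * ∫ s in (0 : ℝ)..t, dirX (direction N J s.toNNReal ω)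

/-- The ordinate `Y(t)` of the particle that starts from the origin and moves with constant speed
`c` in the direction `D(s)` at each time `s`. -/
def posY {Ω : Type*} (c : ℝ) (N : ℝ≥0 → Ω → ℕ) (J : ℕ → Ω → ZMod 4) (t : ℝ≥0) (ω : Ω) : ℝ :=
  c * ∫ s in (0 : ℝ)..t, dirY (direction N J s.toNNReal ω)

/-- `A(α, β) = ½ √(4 λ² p² - c² (α - β)²)`, purely imaginary when the radicand is negative. -/
def coefA (lam p c α β : ℝ) : ℂ :=
  1 / 2 * Complex.sqrt ((4 * lam ^ 2 * p ^ 2 - c ^ 2 * (α - β) ^ 2 : ℝ) : ℂ)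

/-- `B(α, β) = ½ √(4 λ² (1 - p)² - c² (α + β)²)`, purely imaginary when the radicand is
negative. -/
def coefB (lam p c α β : ℝ) : ℂ :=
  1 / 2 * Complex.sqrt ((4 * lam ^ 2 * (1 - p) ^ 2 - c ^ 2 * (α + β) ^ 2 : ℝ) : ℂ)

/-- `(1 + μ / a) e^{a t} + (1 - μ / a) e^{-a t}`; at the removable singularity `a = 0` it has the
value `2 (1 + μ t)` of its continuous extension. -/
def chfFactor (μ t : ℝ) (a : ℂ) : ℂ :=
  if a = 0 then 2 * (1 + (μ : ℂ) * t)
  else (1 + μ / a) * Complex.exp (a * t) + (1 - μ / a) * Complex.exp (-a * t)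

end

open Filter Topology

/-! The phase `α X(t) + β Y(t)` is the time integral of a function of the current direction. Almost
every path has only countably many jump times, so the integral is the limit of its Riemann sums of
mesh `r = t/n`, and by dominated convergence the characteristic function is the limit of the
expectations of products of `n` bounded functions `φ` of the sampled directions.

These expectations are computed exactly (`IsOrthogonalMotion.integral_prod_direction`). With the
Poisson path frozen, the Markov property gives an ordered product of matrices `diag φ * Π ^ m`,
where `Π` is the transition matrix and `m` runs over the Poisson increments. The increments are
i.i.d., so averaging gives the `n`-th power of `diag φ * exp (λ r (Π - 1))`. By a Lie–Trotter limit
(`tendsto_pow_of_hasDerivAt`) these powers tend to `exp (t G)`, with `G` the `phaseGenerator`.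

It remains to solve `u' = G u`, `u(0) = 1`. Each direction is a pair of signs, those of the
velocities of `X - Y` and `X + Y`. A switch flips the first with probability `p` and the second
otherwise, so the system separates into two telegraph equations with rates `λ p` and `λ (1 - p)`.
Products of their solutions solve it, and the sum over the four directions factors into the two
braces. -/

/-! ### Riemann sums along monotone integer-valued paths. -/

theorem tendsto_riemann_sum_of_ae_continuousAt {q : ℝ → ℝ} (M : ℝ) (hM : ∀ x, ‖q x‖ ≤ M)
    (hq : ∀ᵐ x, ContinuousAt q x) :
    Tendsto (fun n : ℕ => ∑ l ∈ Finset.range n, q (l / n) / n) atTop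
      (𝓝 (∫ x in (0 : ℝ)..1, q x)) := by
  -- The Riemann sum is the integral of the step function that rounds its argument down to the grid,
  -- so dominated convergence applies.
  have key : ∀ᶠ n : ℕ in atTop,
      ∫ x in (0 : ℝ)..1, q (⌊x * n⌋₊ / n) = ∑ l ∈ Finset.range n, q (l / n) / n := by
    filter_upwards [eventually_gt_atTop 0] with n hn
    have hn' : (0 : ℝ) < n := by exact_mod_cast hn
    have hI : ∀ l : ℕ, Set.EqOn (fun _ => q (l / n)) (fun x : ℝ => q (⌊x * n⌋₊ / n))
        (Set.Ioo ((l : ℝ) / n) (((l + 1 : ℕ) : ℝ) / n)) := by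
      intro l x hx
      have h1 : (l : ℝ) < x * n := (div_lt_iff₀ hn').1 hx.1
      have h2 : x * n < ((l + 1 : ℕ) : ℝ) := (lt_div_iff₀ hn').1 hx.2
      have : ⌊x * n⌋₊ = l := by
        rw [Nat.floor_eq_iff (by linarith [(Nat.cast_nonneg l : (0 : ℝ) ≤ l)])]
        exact ⟨h1.le, by push_cast at h2; exact h2⟩
      simp [this]
    have hle : ∀ l : ℕ, (l : ℝ) / n ≤ ((l + 1 : ℕ) : ℝ) / n := fun l => by gcongr; simp
    have hint : ∀ l : ℕ, IntervalIntegrable (fun x : ℝ => q (⌊x * n⌋₊ / n)) volume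
        ((l : ℝ) / n) (((l + 1 : ℕ) : ℝ) / n) := fun l => by
      refine (intervalIntegrable_const (c := q (l / n))).congr_ae ?_
      rw [Set.uIoc_of_le (hle l), ← Measure.restrict_congr_set Ioo_ae_eq_Ioc]
      exact (ae_restrict_mem measurableSet_Ioo).mono fun x hx => hI l hx
    have := intervalIntegral.sum_integral_adjacent_intervals (μ := volume)
      (f := fun x : ℝ => q (⌊x * n⌋₊ / n)) (a := fun l : ℕ => (l : ℝ) / n) (n := n)
      (fun l _ => hint l)
    rw [show (1 : ℝ) = (n : ℝ) / n by field_simp, show (0 : ℝ) = ((0 : ℕ) : ℝ) / n by simp, ← this]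
    refine Finset.sum_congr rfl fun l _ => ?_
    rw [intervalIntegral.integral_of_le (hle l), integral_Ioc_eq_integral_Ioo, ← setIntegral_congr_fun measurableSet_Ioo (hI l)]
    have : ((l : ℝ) + 1) / n - l / n = 1 / n := by ring
    simp [measureReal_def, this]
    ring
  refine Tendsto.congr' key ?_
  refine intervalIntegral.tendsto_integral_filter_of_dominated_convergence (fun _ => M) ?_ ?_
    intervalIntegrable_const ?_
  · refine Eventually.of_forall fun n => Measurable.aestronglyMeasurable ?_
    exact (measurable_from_top (f := fun k : ℕ => q (k / n))).comp
      (Nat.measurable_floor.comp (measurable_id.mul_const _))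
  · exact Eventually.of_forall fun n => Eventually.of_forall fun x _ => hM _
  · filter_upwards [hq] with x hx hx01
    refine hx.tendsto.comp ?_
    have h0 : 0 ≤ x := by
      rw [Set.uIoc_of_le zero_le_one] at hx01; exact hx01.1.le
    have := (tendsto_nat_floor_mul_div_atTop h0).comp (tendsto_natCast_atTop_atTop (R := ℝ))
    exact this

theorem continuousAt_comp_of_monotone_nat {N : ℝ → ℕ} (hN : Monotone N) (g : ℕ → ℝ) :
    ∀ᵐ x, ContinuousAt (fun x => g (N x)) x := by
  filter_upwards [hN.countable_not_continuousAt.ae_notMem volume] with x hx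
  exact (continuous_of_discreteTopology.continuousAt (f := g)).comp (not_not.1 hx)

theorem tendsto_riemann_sum_monotone_path {N : ℝ≥0 → ℕ} (hN : Monotone N) (g : ℕ → ℝ) (M : ℝ)
    (hM : ∀ x, ‖g x‖ ≤ M) (t : ℝ≥0) :
    Tendsto (fun n : ℕ => ∑ l ∈ Finset.range n, (t / n : ℝ) * g (N (l * (t / n)))) atTop
      (𝓝 (∫ s in (0 : ℝ)..t, g (N s.toNNReal))) := by
  have hmono : Monotone fun x : ℝ => N (t * x).toNNReal := fun x y hxy =>
    hN (Real.toNNReal_le_toNNReal (mul_le_mul_of_nonneg_left hxy t.2))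
  have := (tendsto_riemann_sum_of_ae_continuousAt (q := fun x => g (N (t * x).toNNReal)) M
    (fun x => hM _) (continuousAt_comp_of_monotone_nat hmono g)).const_mul (t : ℝ)
  have h2 := intervalIntegral.smul_integral_comp_mul_left (a := 0) (b := 1)
    (fun s : ℝ => g (N s.toNNReal)) (t : ℝ)
  simp only [mul_zero, mul_one, smul_eq_mul] at h2
  rw [h2] at this
  refine this.congr fun n => ?_
  rw [Finset.mul_sum]
  refine Finset.sum_congr rfl fun l _ => ?_
  have : (t * (l / n) : ℝ).toNNReal = l * (t / n) := by
    rw [show (t * (l / n) : ℝ) = ((l * (t / n) : ℝ≥0) : ℝ) by push_cast; ring, Real.toNNReal_coe]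
  rw [this]; ring

theorem intervalIntegrable_comp_monotone_path {N : ℝ≥0 → ℕ} (hN : Monotone N) (g : ℕ → ℝ) (M : ℝ)
    (hM : ∀ x, ‖g x‖ ≤ M) (a b : ℝ) :
    IntervalIntegrable (fun s : ℝ => g (N s.toNNReal)) volume a b := by
  have hm : Measurable fun s : ℝ => g (N s.toNNReal) :=
    measurable_from_top.comp (hN.comp (fun _ _ h => Real.toNNReal_le_toNNReal h)).measurable
  refine (intervalIntegrable_const (c := M)).mono_fun hm.aestronglyMeasurable ?_
  exact Eventually.of_forall fun s => (hM _).trans (le_abs_self M)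

/-! ### Lie–Trotter limits in a Banach algebra. -/

theorem norm_pow_sub_pow_le {A : Type*} [NormedRing A] [NormOneClass A] {x y : A} {M : ℝ}
    (hx : ‖x‖ ≤ M) (hy : ‖y‖ ≤ M) (hM : 1 ≤ M) (n : ℕ) :
    ‖x ^ n - y ^ n‖ ≤ n * M ^ n * ‖x - y‖ := by
  have hM0 : 0 ≤ M := zero_le_one.trans hM
  induction n with
  | zero => simp
  | succ n ih =>
    have : x ^ (n + 1) - y ^ (n + 1) = x ^ n * (x - y) + (x ^ n - y ^ n) * y := by
      rw [pow_succ, pow_succ]; noncomm_ring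
    rw [this]
    have hxn : ‖x ^ n‖ ≤ M ^ n := (norm_pow_le x n).trans (pow_le_pow_left₀ (norm_nonneg _) hx n)
    calc _ ≤ ‖x ^ n‖ * ‖x - y‖ + ‖x ^ n - y ^ n‖ * ‖y‖ :=
          (norm_add_le _ _).trans (add_le_add (norm_mul_le _ _) (norm_mul_le _ _))
      _ ≤ M ^ (n + 1) * ‖x - y‖ + n * M ^ n * ‖x - y‖ * M := by
          gcongr
          exact hxn.trans (pow_le_pow_right₀ hM n.le_succ)
      _ = _ := by push_cast; ring

/-- `S (t/n)` and `exp ((t/n) G)` differ by `o(1/n)`. Telescoping the `n`-th powers costs a factor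
`n` times a power of `1 + C |t/n|`, which stays below `exp (C |t|)`. -/
theorem tendsto_pow_of_hasDerivAt {A : Type*} [NormedRing A] [NormOneClass A] [NormedAlgebra ℝ A]
    [CompleteSpace A] {S : ℝ → A} {G : A} (hS : HasDerivAt S G 0) (hS0 : S 0 = 1) (t : ℝ) :
    Tendsto (fun n : ℕ => S (t / n) ^ n) atTop (𝓝 (NormedSpace.exp (t • G))) := by
  have hE : HasDerivAt (fun s : ℝ => NormedSpace.exp (s • G)) G 0 := by
    simpa using hasDerivAt_exp_smul_const (𝕂 := ℝ) G 0
  have hh : Tendsto (fun n : ℕ => t / n) atTop (𝓝 0) := tendsto_const_div_atTop_nhds_zero_nat t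
  have hsub : (fun s : ℝ => S s - NormedSpace.exp (s • G)) =o[𝓝 0] fun s => s := by
    have := (hS.sub hE).isLittleO
    simpa [hS0] using this
  have hbd : ∀ {f : ℝ → A}, HasDerivAt f G 0 → f 0 = 1 → ∃ C : ℝ, 0 ≤ C ∧
      ∀ᶠ s in 𝓝 (0 : ℝ), ‖f s‖ ≤ 1 + C * |s| := by
    intro f hf hf0
    obtain ⟨C, hC0, hC⟩ := hf.differentiableAt.isBigO_sub.exists_nonneg
    refine ⟨C, hC0, hC.bound.mono fun s hs => ?_⟩
    rw [hf0, sub_zero, Real.norm_eq_abs] at hs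
    calc ‖f s‖ = ‖1 + (f s - 1)‖ := by congr 1; abel
      _ ≤ ‖(1 : A)‖ + ‖f s - 1‖ := norm_add_le _ _
      _ ≤ _ := by rw [norm_one]; gcongr
  obtain ⟨C₁, hC₁, h₁⟩ := hbd hS hS0
  obtain ⟨C₂, hC₂, h₂⟩ := hbd hE (by simp)
  set C := max C₁ C₂
  have hdiff : Tendsto (fun n : ℕ => S (t / n) ^ n - NormedSpace.exp ((t / n) • G) ^ n) atTop
      (𝓝 0) := by
    have hlim : Tendsto (fun n : ℕ => Real.exp (C * |t|) *
        (n * ‖S (t / n) - NormedSpace.exp ((t / n) • G)‖)) atTop (𝓝 0) := by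
      rw [← mul_zero (Real.exp (C * |t|))]
      refine Tendsto.const_mul _ ?_
      have ho := (hsub.comp_tendsto hh).norm_left
      have hO : (fun n : ℕ => (n : ℝ)) =O[atTop] fun n : ℕ => (n : ℝ) := Asymptotics.isBigO_refl _ _
      have := hO.mul_isLittleO ho
      refine (this.trans_isBigO ?_).tendsto_zero_of_tendsto (tendsto_const_nhds (x := t)) |>.congr ?_
      · refine Asymptotics.IsBigO.of_bound 1 ?_
        filter_upwards [eventually_gt_atTop 0] with n hn
        have : (n : ℝ) ≠ 0 := by exact_mod_cast hn.ne'
        simp only [Function.comp_def]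
        rw [mul_div_cancel₀ _ this, one_mul]
      · intro n; rfl
    refine squeeze_zero_norm' ?_ hlim
    filter_upwards [hh.eventually h₁, hh.eventually h₂, eventually_gt_atTop 0] with n hn₁ hn₂ hn
    have hn' : (0 : ℝ) < n := by exact_mod_cast hn
    have hM : 1 ≤ 1 + C * |t / n| := by
      have := mul_nonneg (hC₁.trans (le_max_left C₁ C₂)) (abs_nonneg (t / n))
      linarith
    refine (norm_pow_sub_pow_le (M := 1 + C * |t / n|) (hn₁.trans ?_) (hn₂.trans ?_) hM n).trans ?_
    · gcongr; exact le_max_left _ _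
    · gcongr; exact le_max_right _ _
    · rw [mul_comm (n : ℝ), mul_assoc]
      gcongr
      calc (1 + C * |t / n|) ^ n ≤ Real.exp (C * |t / n|) ^ n := by
            gcongr; rw [add_comm]; exact Real.add_one_le_exp _
        _ = Real.exp (C * |t|) := by
            rw [← Real.exp_nat_mul, abs_div, Nat.abs_cast]
            congr 1
            field_simp
  have := hdiff.add_const (NormedSpace.exp (t • G))
  rw [zero_add] at this
  refine this.congr' ?_
  filter_upwards [eventually_gt_atTop 0] with n hn
  have hn' : (n : ℝ) ≠ 0 := by exact_mod_cast hn.ne'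
  let _ : NormedAlgebra ℚ A := NormedAlgebra.restrictScalars ℚ ℝ A
  rw [← NormedSpace.exp_nsmul, ← Nat.cast_smul_eq_nsmul ℝ, smul_smul, mul_div_cancel₀ _ hn',
    sub_add_cancel]

/-! ### The direction chain sampled at deterministic steps. -/

section Probability

variable {Ω : Type*} [MeasurableSpace Ω]

theorem integral_comp_eq_sum {S : Type*} [Fintype S] [MeasurableSpace S]
    [MeasurableSingletonClass S] {P : Measure Ω} [IsFiniteMeasure P] {X : Ω → S}
    (hX : Measurable X) (H : S → ℂ) :
    ∫ ω, H (X ω) ∂P = ∑ s, (P.real {ω | X ω = s} : ℂ) * H s := by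
  have := Measure.isFiniteMeasure_map P X
  rw [← integral_map (f := H) hX.aemeasurable
    (Measurable.of_discrete (f := H)).aestronglyMeasurable, integral_fintype .of_finite]
  refine Finset.sum_congr rfl fun s _ => ?_
  rw [map_measureReal_apply hX (measurableSet_singleton s), Complex.real_smul]
  rfl

/-- The complex matrix of the transition probabilities of the direction chain. -/
def turnMatrix (p : ℝ) : Matrix (ZMod 4) (ZMod 4) ℂ := Matrix.of fun i j => (turnProb p i j : ℂ)

/-- One-step Markov property in integrated form: both sides are finite sums over paths, and a path's
probability gains one transition factor when it is extended by a step. -/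
theorem IsDirectionChain.integral_mul_succ {p : ℝ} {J : ℕ → Ω → ZMod 4} {P : Measure Ω}
    [IsProbabilityMeasure P] (h : IsDirectionChain p J P) (n : ℕ) (F : (ℕ → ZMod 4) → ℂ)
    (hF : ∀ x y, (∀ k ≤ n, x k = y k) → F x = F y) (g : ZMod 4 → ℂ) :
    ∫ ω, F (fun k => J k ω) * g (J (n + 1) ω) ∂P =
      ∫ ω, F (fun k => J k ω) * (turnMatrix p).mulVec g (J n ω) ∂P := by
  -- Continues a finite path by the constant `b`, giving the infinite index sequence that
  -- `path_prob` requires; `b` is both the state at time `n + 1` and a filler afterwards.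
  let e : (Fin (n + 1) → ZMod 4) → ZMod 4 → ℕ → ZMod 4 := fun i b k =>
    if h : k < n + 1 then i ⟨k, h⟩ else b
  have he : ∀ ω b k, k ≤ n → e (fun k => J k ω) b k = J k ω := fun ω b k hk => by
    simp [e, not_lt.2 hk]
  have hFe : ∀ ω, F (fun k => J k ω) = F (e (fun k => J k ω) 0) := fun ω =>
    hF _ _ fun k hk => (he ω 0 k hk).symm
  have hr : Measurable fun ω => (fun k : Fin (n + 1) => J k ω) :=
    measurable_pi_iff.2 fun k => h.measurable k
  have h1 : ∀ i b, {ω | (fun k : Fin (n + 1) => J k ω) = i} = {ω | ∀ k ≤ n, J k ω = e i b k} := by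
    intro i b
    ext ω
    simp only [Set.mem_ofPred_eq, funext_iff, e]
    constructor
    · intro H k hk
      simp [Nat.lt_succ_of_le hk, ← H ⟨k, Nat.lt_succ_of_le hk⟩]
    · rintro H ⟨k, hk⟩
      simpa [hk] using H k (Nat.le_of_lt_succ hk)
  have h2 : ∀ i b, {ω | ((fun k : Fin (n + 1) => J k ω), J (n + 1) ω) = (i, b)} =
      {ω | ∀ k ≤ n + 1, J k ω = e i b k} := by
    intro i b
    ext ω
    have := Set.ext_iff.1 (h1 i b) ω
    simp only [Set.mem_ofPred_eq] at this
    simp only [Set.mem_ofPred_eq, Prod.mk.injEq, this]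
    constructor
    · rintro ⟨H, H'⟩ k hk
      rcases Nat.le_succ_iff.1 hk with hk | rfl
      · exact H k hk
      · simpa [e] using H'
    · exact fun H => ⟨fun k hk => H k (hk.trans n.le_succ), by simpa [e] using H _ le_rfl⟩
  have hP : ∀ i b, P.real {ω | ((fun k : Fin (n + 1) => J k ω), J (n + 1) ω) = (i, b)} =
      P.real {ω | (fun k : Fin (n + 1) => J k ω) = i} * turnProb p (i (Fin.last n)) b := by
    intro i b
    rw [h2, h1 i b, h.path_prob, h.path_prob, Finset.prod_range_succ, ← mul_assoc]
    congr 1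
    simp [e, Fin.last]
  simp_rw [hFe]
  rw [integral_comp_eq_sum (X := fun ω => ((fun k : Fin (n + 1) => J k ω), J (n + 1) ω))
    (hr.prodMk (h.measurable _)) (fun x => F (e x.1 0) * g x.2)]
  have := integral_comp_eq_sum (P := P) hr
    (fun x => F (e x 0) * (turnMatrix p).mulVec g (x (Fin.last n)))
  simp only [Fin.val_last] at this
  rw [this, Fintype.sum_prod_type]
  refine Finset.sum_congr rfl fun i _ => ?_
  simp_rw [hP, Matrix.mulVec, dotProduct, turnMatrix, Matrix.of_apply, Finset.mul_sum]
  refine Finset.sum_congr rfl fun b _ => ?_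
  push_cast
  ring

theorem IsDirectionChain.integral_mul_add {p : ℝ} {J : ℕ → Ω → ZMod 4} {P : Measure Ω}
    [IsProbabilityMeasure P] (h : IsDirectionChain p J P) (n m : ℕ) (F : (ℕ → ZMod 4) → ℂ)
    (hF : ∀ x y, (∀ k ≤ n, x k = y k) → F x = F y) (g : ZMod 4 → ℂ) :
    ∫ ω, F (fun k => J k ω) * g (J (n + m) ω) ∂P =
      ∫ ω, F (fun k => J k ω) * (turnMatrix p ^ m).mulVec g (J n ω) ∂P := by
  induction m generalizing g with
  | zero => simp
  | succ m ih =>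
    rw [← add_assoc, h.integral_mul_succ (n + m) F
      (fun x y hxy => hF x y fun k hk => hxy k (hk.trans (Nat.le_add_right n m))), ih]
    simp [pow_succ]

theorem IsDirectionChain.integral_initial {p : ℝ} {J : ℕ → Ω → ZMod 4} {P : Measure Ω}
    [IsProbabilityMeasure P] (h : IsDirectionChain p J P) (g : ZMod 4 → ℂ) :
    ∫ ω, g (J 0 ω) ∂P = 1 / 4 * ∑ i, g i := by
  rw [integral_comp_eq_sum (h.measurable 0), Finset.mul_sum]
  refine Finset.sum_congr rfl fun i _ => ?_
  have := h.path_prob 0 fun _ => i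
  simp only [Nat.le_zero_eq, forall_eq, Finset.range_zero, Finset.prod_empty] at this
  rw [this]
  norm_num

/-- The free function `g` makes the induction work: the Markov property moves the last sample back
to `z k`, and the new `φ` factor and transition power are absorbed into `g`. -/
theorem IsDirectionChain.integral_prod_comp {p : ℝ} {J : ℕ → Ω → ZMod 4} {P : Measure Ω}
    [IsProbabilityMeasure P] (h : IsDirectionChain p J P) {z : ℕ → ℕ} (hz : Monotone z)
    (hz0 : z 0 = 0) (φ : ZMod 4 → ℂ) (k : ℕ) (g : ZMod 4 → ℂ) :
    ∫ ω, (∏ l ∈ Finset.range k, φ (J (z l) ω)) * g (J (z k) ω) ∂P =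
      1 / 4 * ∑ i, (((List.range k).map fun l =>
        Matrix.diagonal φ * turnMatrix p ^ (z (l + 1) - z l)).prod).mulVec g i := by
  induction k generalizing g with
  | zero => simpa [hz0] using h.integral_initial g
  | succ k ih =>
    have hadd : z (k + 1) = z k + (z (k + 1) - z k) :=
      (Nat.add_sub_cancel' (hz k.le_succ)).symm
    have := h.integral_mul_add (z k) (z (k + 1) - z k)
      (fun x => ∏ l ∈ Finset.range (k + 1), φ (x (z l))) (fun x y hxy =>
        Finset.prod_congr rfl fun l hl => by
          rw [hxy _ (hz (Nat.le_of_lt_succ (Finset.mem_range.1 hl)))]) g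
    rw [← hadd] at this
    rw [this, List.prod_range_succ, ← Matrix.mulVec_mulVec, ← ih]
    refine integral_congr_ae (Eventually.of_forall fun ω => ?_)
    simp only [Finset.prod_range_succ, ← Matrix.mulVec_mulVec, Matrix.mulVec_diagonal]
    ring

/-! ### Averaging over the Poisson increments. -/

section MatrixNorm

attribute [local instance] Matrix.linftyOpNormedRing Matrix.linftyOpNormedAlgebra

/-- Each new factor is independent of the product before it, so expectation is multiplicative even
though the matrices need not commute. -/
theorem integral_prod_matrix_of_iIndepFun {n : Type*} [Fintype n] [DecidableEq n]
    {P : Measure Ω} {Q : Measure ℕ} {ξ : ℕ → Ω → ℕ} (hm : ∀ l, Measurable (ξ l))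
    (hind : iIndepFun ξ P) (hlaw : ∀ l, HasLaw (ξ l) Q P) (A : ℕ → Matrix n n ℂ)
    (hA : ∀ i j, Integrable (fun m => A m i j) Q) (K : Matrix n n ℂ)
    (hK : ∀ i j, ∫ m, A m i j ∂Q = K i j) (k : ℕ) (i j : n) :
    Integrable (fun ω => ((List.range k).map fun l => A (ξ l ω)).prod i j) P ∧
      ∫ ω, ((List.range k).map fun l => A (ξ l ω)).prod i j ∂P = (K ^ k) i j := by
  have := hind.isProbabilityMeasure
  induction k generalizing j with
  | zero => simp
  | succ k ih =>
    have hAi : ∀ a, Integrable (fun ω => A (ξ k ω) a j) P := fun a => by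
      have := hA a j
      rw [← (hlaw k).map_eq] at this
      exact this.comp_measurable (hm k)
    have hAK : ∀ a, ∫ ω, A (ξ k ω) a j ∂P = K a j := fun a => by
      rw [← hK, ← (hlaw k).integral_comp (hA a j).aestronglyMeasurable]
      rfl
    have hindep : ∀ a, IndepFun (fun ω => ((List.range k).map fun l => A (ξ l ω)).prod i a)
        (fun ω => A (ξ k ω) a j) P := by
      intro a
      have h1 := hind.indepFun_finset (Finset.range k) {k} (by simp) hm
      let Φ : ((l : Finset.range k) → ℕ) → ℂ := fun x =>
        ((List.range k).map fun l =>
          A (if h : l ∈ Finset.range k then x ⟨l, h⟩ else 0)).prod i a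
      have h2 := h1.comp (φ := Φ) (ψ := fun x => A (x ⟨k, by simp⟩) a j)
        Measurable.of_discrete Measurable.of_discrete
      convert! h2 using 2 with ω
      simp only [Function.comp, Φ]
      have hl : (List.range k).map (fun l => A (ξ l ω)) = (List.range k).map fun l =>
          A (if h : l ∈ Finset.range k then ξ l ω else 0) :=
        List.map_congr_left fun l hl => by rw [dif_pos (by simpa using hl)]
      rw [hl]
    have hprod : ∀ ω, ((List.range (k + 1)).map fun l => A (ξ l ω)).prod i j =
        ∑ a, ((List.range k).map fun l => A (ξ l ω)).prod i a * A (ξ k ω) a j := fun ω => by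
      rw [List.prod_range_succ, Matrix.mul_apply]
    simp_rw [hprod]
    have hint : ∀ a, Integrable (fun ω => ((List.range k).map fun l => A (ξ l ω)).prod i a *
        A (ξ k ω) a j) P := fun a => (hindep a).integrable_mul (ih a).1 (hAi a)
    refine ⟨integrable_finsetSum _ fun a _ => hint a, ?_⟩
    rw [integral_finsetSum _ fun a _ => hint a, pow_succ, Matrix.mul_apply]
    refine Finset.sum_congr rfl fun a _ => ?_
    rw [(hindep a).integral_fun_mul_eq_mul_integral (ih a).1.1 (hAi a).1, (ih a).2, hAK]

/-- The Poisson generating function evaluated at a matrix; the scalar `exp (-r)` merges into the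
exponential because `1` commutes with `M`. -/
theorem hasSum_poisson_matrix {n : Type*} [Fintype n] [DecidableEq n] (r : ℝ)
    (D M : Matrix n n ℂ) (i j : n) :
    HasSum (fun m : ℕ => (Real.exp (-r) * r ^ m / (m.factorial : ℝ)) • (D * M ^ m) i j)
      ((D * NormedSpace.exp (r • (M - 1))) i j) := by
  have h0 : NormedSpace.exp (r • (M - 1)) = Real.exp (-r) • NormedSpace.exp (r • M) := by
    have hr : NormedSpace.exp ((-r) • (1 : Matrix n n ℂ)) = Real.exp (-r) • 1 := by
      have := NormedSpace.algebraMap_exp_comm (𝕂 := ℝ) (𝔸 := Matrix n n ℂ) (-r)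
      rw [← Real.exp_eq_exp_ℝ, Algebra.algebraMap_eq_smul_one, Algebra.algebraMap_eq_smul_one] at this
      exact this.symm
    rw [show r • (M - 1) = (-r) • (1 : Matrix n n ℂ) + r • M by rw [smul_sub, neg_smul]; abel,
      Matrix.exp_add_of_commute _ _ (((Commute.one_left M).smul_left (-r)).smul_right r), hr]
    simp
  have h1 := (NormedSpace.exp_series_hasSum_exp' (𝕂 := ℝ) (r • M)).mul_left D
  have h2 := (h1.const_smul (Real.exp (-r)))
  have h3 := (Pi.hasSum.1 ((Pi.hasSum.1 h2) i)) j
  rw [h0, Matrix.mul_smul]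
  convert! h3 using 2 with m
  simp only [smul_pow, Matrix.mul_smul, Matrix.smul_apply, smul_smul]
  congr 1
  ring

theorem integrable_poisson_matrix {n : Type*} [Fintype n] [DecidableEq n] (r : ℝ≥0)
    (D M : Matrix n n ℂ) (i j : n) :
    Integrable (fun m : ℕ => (D * M ^ m) i j) (poissonMeasure r) := by
  rw [integrable_poissonMeasure_iff]
  refine (hasSum_poisson_matrix r D M i j).summable.norm.congr fun m => ?_
  rw [norm_smul, Real.norm_of_nonneg (by positivity)]

theorem integral_poisson_matrix {n : Type*} [Fintype n] [DecidableEq n] (r : ℝ≥0)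
    (D M : Matrix n n ℂ) (i j : n) :
    ∫ m : ℕ, (D * M ^ m) i j ∂(poissonMeasure r) =
      (D * NormedSpace.exp ((r : ℝ) • (M - 1))) i j := by
  rw [integral_poissonMeasure]
  exact (hasSum_poisson_matrix r D M i j).tsum_eq

theorem IsOrthogonalMotion.integral_prod_direction {P : Measure Ω} [IsProbabilityMeasure P]
    {lam : ℝ≥0} {p : ℝ} {N : ℝ≥0 → Ω → ℕ} {J : ℕ → Ω → ZMod 4}
    (h : IsOrthogonalMotion lam p N J P) (φ : ZMod 4 → ℂ) (hφ : ∀ j, ‖φ j‖ ≤ 1) (r : ℝ≥0)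
    (k : ℕ) :
    ∫ ω, ∏ l ∈ Finset.range k, φ (direction N J (l * r) ω) ∂P =
      1 / 4 * ∑ i, ((Matrix.diagonal φ *
        NormedSpace.exp (((lam * r : ℝ≥0) : ℝ) • (turnMatrix p - 1))) ^ k).mulVec 1 i := by
  let Z : Ω → ℕ → ℕ := fun ω l => N (l * r) ω
  let J' : Ω → ℕ → ZMod 4 := fun ω n => J n ω
  let Φ : (ℕ → ℕ) × (ℕ → ZMod 4) → ℂ := fun x => ∏ l ∈ Finset.range k, φ (x.2 (x.1 l))
  have hZ : Measurable Z := measurable_pi_iff.2 fun l => h.poisson.measurable _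
  have hJ' : Measurable J' := measurable_pi_iff.2 h.chain.measurable
  have hev : Measurable fun x : ℕ × (ℕ → ZMod 4) => x.2 x.1 :=
    measurable_from_prod_countable_right fun m => measurable_pi_apply m
  have hΦ : Measurable Φ := by
    refine Finset.measurable_prod _ fun l _ => ?_
    have h1 : Measurable fun x : (ℕ → ℕ) × (ℕ → ZMod 4) => x.2 (x.1 l) :=
      Measurable.comp (g := fun x : ℕ × (ℕ → ZMod 4) => x.2 x.1) 
        (f := fun x : (ℕ → ℕ) × (ℕ → ZMod 4) => (x.1 l, x.2)) hev
        (((measurable_pi_apply l).comp measurable_fst).prodMk measurable_snd)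
    exact (Measurable.of_discrete (f := φ)).comp h1
  have hΦb : ∀ x, ‖Φ x‖ ≤ 1 := fun x => by
    rw [norm_prod]
    exact Finset.prod_le_one (fun _ _ => norm_nonneg _) fun _ _ => hφ _
  have hind : IndepFun Z J' P :=
    h.indep.comp (φ := fun x : ℝ≥0 → ℕ => fun l : ℕ => x (l * r)) (ψ := id)
      (measurable_pi_iff.2 fun l => measurable_pi_apply _) measurable_id
  have hPZ := Measure.isProbabilityMeasure_map (μ := P) hZ.aemeasurable
  have hPJ := Measure.isProbabilityMeasure_map (μ := P) hJ'.aemeasurable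
  -- Independence of `N` and `J` allows freezing the sampled counts and averaging over the chain
  -- alone.
  have hfub : ∫ ω, ∏ l ∈ Finset.range k, φ (direction N J (l * r) ω) ∂P =
      ∫ ω, ∫ ω', Φ (Z ω, J' ω') ∂P ∂P := by
    have hInt : Integrable Φ ((P.map Z).prod (P.map J')) :=
      Integrable.of_bound hΦ.aestronglyMeasurable 1 (Eventually.of_forall hΦb)
    calc _ = ∫ ω, Φ (Z ω, J' ω) ∂P := rfl
      _ = ∫ x, Φ x ∂((P.map Z).prod (P.map J')) := by
        rw [← hind.map_prod_eq_prod_map_map hZ.aemeasurable hJ'.aemeasurable,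
          integral_map (hZ.prodMk hJ').aemeasurable hΦ.aestronglyMeasurable]
      _ = ∫ ω, ∫ y, Φ (Z ω, y) ∂(P.map J') ∂P := by
        rw [integral_prod _ hInt, integral_map hZ.aemeasurable hInt.integral_prod_left.1]
      _ = _ := by
        refine integral_congr_ae (Eventually.of_forall fun ω => ?_)
        exact integral_map hJ'.aemeasurable
          (hΦ.comp (measurable_const.prodMk measurable_id)).aestronglyMeasurable
  have hmono : Monotone fun l : ℕ => (l : ℝ≥0) * r := fun a b hab => by
    dsimp only
    gcongr
  have hinner : ∀ᵐ ω ∂P, ∫ ω', Φ (Z ω, J' ω') ∂P =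
      ∑ i, ∑ j, 1 / 4 * ((List.range k).map fun l =>
        Matrix.diagonal φ * turnMatrix p ^ (Z ω (l + 1) - Z ω l)).prod i j := by
    filter_upwards [h.poisson.zero, h.poisson.monotone] with ω h0 hN
    have := h.chain.integral_prod_comp (z := Z ω) (hN.comp hmono) (by simpa [Z] using h0) φ k 1
    simp only [Pi.one_apply, mul_one] at this
    simp only [Φ, J', this, Matrix.mulVec, dotProduct, Finset.mul_sum, Pi.one_apply, mul_one]
  rw [hfub, integral_congr_ae hinner]
  have hlaw : ∀ l, HasLaw (fun ω => Z ω (l + 1) - Z ω l) (poissonMeasure (lam * r)) P := by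
    intro l
    have := h.poisson.increment _ _ (hmono l.le_succ)
    have hr : (((l.succ : ℕ) : ℝ≥0) * r) - l * r = r := by
      rw [Nat.cast_succ, add_mul, one_mul, add_tsub_cancel_left]
    dsimp only at this
    rw [hr] at this
    exact this
  have hms : ∀ l, Measurable fun ω => Z ω (l + 1) - Z ω l := fun l =>
    (h.poisson.measurable _).sub (h.poisson.measurable _)
  have hB := integral_prod_matrix_of_iIndepFun (ξ := fun l ω => Z ω (l + 1) - Z ω l) hms
    (h.poisson.indep.nat hmono) hlaw (fun m => Matrix.diagonal φ * turnMatrix p ^ m)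
    (integrable_poisson_matrix _ _ _) _ (integral_poisson_matrix _ _ _) k
  rw [integral_finsetSum _ fun i _ => integrable_finsetSum _ fun j _ => (hB i j).1.const_mul _]
  simp_rw [integral_finsetSum _ fun j _ => (hB _ j).1.const_mul _, integral_const_mul, (hB _ _).2]
  simp [Matrix.mulVec, dotProduct, Finset.mul_sum]

end MatrixNorm

end Probability

/-! ### The generator and its explicit exponential. -/

section MatrixNorm

attribute [local instance] Matrix.linftyOpNormedRing Matrix.linftyOpNormedAlgebra

/-- Uniqueness for the linear system: `exp ((t - s) G) (u s)` has zero derivative in `s`, so its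
values at `0` and `t` agree. -/
theorem exp_smul_mulVec_of_hasDerivAt {n : Type*} [Fintype n] [DecidableEq n] [Nonempty n]
    {G : Matrix n n ℂ} {u : ℝ → n → ℂ}
    (hu : ∀ s i, HasDerivAt (fun s => u s i) (G.mulVec (u s) i) s) (t : ℝ) :
    (NormedSpace.exp (t • G)).mulVec (u 0) = u t := by
  funext i
  have hE : ∀ s j, HasDerivAt (fun s : ℝ => NormedSpace.exp ((t - s) • G) i j)
      (-(NormedSpace.exp ((t - s) • G) * G) i j) s := by
    intro s j
    have h1 := (hasDerivAt_exp_smul_const (𝕂 := ℝ) G (t - s)).scomp s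
      ((hasDerivAt_id s).const_sub t)
    have h2 := ((Matrix.entryLinearMap ℝ ℂ i j).toContinuousLinearMap.hasFDerivAt).comp_hasDerivAt
      s h1
    convert! h2 using 1
    simp only [neg_smul, one_smul]
    rfl
  have hw : ∀ s, HasDerivAt
      (fun s : ℝ => ∑ j, NormedSpace.exp ((t - s) • G) i j * u s j) 0 s := by
    intro s
    have := HasDerivAt.fun_sum (u := Finset.univ) fun j _ => (hE s j).mul (hu s j)
    convert! this using 1
    have h3 : ((NormedSpace.exp ((t - s) • G) * G).mulVec (u s)) i =
        ((NormedSpace.exp ((t - s) • G)).mulVec (G.mulVec (u s))) i := by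
      rw [Matrix.mulVec_mulVec]
    simp only [Matrix.mulVec, dotProduct] at h3
    simp only [Finset.sum_add_distrib, neg_mul, Finset.sum_neg_distrib, h3]
    simp [Matrix.mulVec, dotProduct]
  have := is_const_of_deriv_eq_zero (fun s => (hw s).differentiableAt) (fun s => (hw s).deriv) 0 t
  simpa [Matrix.mulVec, dotProduct, Matrix.one_apply] using this

/-- The solution of the telegraph equations `f' = i γ f - μ f + μ f₋`, `f₋' = - i γ f₋ - μ f₋ + μ f`
with initial values `1`. -/
theorem exists_telegraph_solution (μ γ : ℝ) (a : ℂ) (ha : a ^ 2 = (μ : ℂ) ^ 2 - (γ : ℂ) ^ 2) :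
    ∃ f g : ℝ → ℂ, f 0 = 1 ∧ g 0 = 1 ∧
      (∀ s, HasDerivAt f (Complex.I * γ * f s - μ * f s + μ * g s) s) ∧
      (∀ s, HasDerivAt g (-(Complex.I * γ) * g s - μ * g s + μ * f s) s) ∧
      ∀ s : ℝ, f s + g s = Complex.exp (-μ * s) * chfFactor μ s a := by
  -- `C` is `cosh (a s)` and `S` is `sinh (a s) / a`, replaced by `1` and `s` when `a = 0`; from
  -- here on both cases are treated alike.
  obtain ⟨C, S, hC0, hS0, hC, hS, hF⟩ : ∃ C S : ℝ → ℂ, C 0 = 1 ∧ S 0 = 0 ∧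
      (∀ s, HasDerivAt C (a ^ 2 * S s) s) ∧ (∀ s, HasDerivAt S (C s) s) ∧
      ∀ s : ℝ, chfFactor μ s a = 2 * (C s + μ * S s) := by
    by_cases h : a = 0
    · refine ⟨fun _ => 1, fun s => s, rfl, by simp, fun s => ?_, fun s => ?_, fun s => ?_⟩
      · simpa [h] using hasDerivAt_const s (1 : ℂ)
      · exact (hasDerivAt_id s).ofReal_comp
      · simp [chfFactor, h]
    · have he : ∀ b : ℂ, ∀ s : ℝ, HasDerivAt (fun s : ℝ => Complex.exp (b * s))
          (b * Complex.exp (b * s)) s := fun b s => by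
        have := (((hasDerivAt_id s).ofReal_comp).const_mul b).cexp
        simpa [mul_comm] using this
      refine ⟨fun s => (Complex.exp (a * s) + Complex.exp (-a * s)) / 2,
        fun s => (Complex.exp (a * s) - Complex.exp (-a * s)) / (2 * a), by simp, by simp,
        fun s => ?_, fun s => ?_, fun s => ?_⟩
      · convert! ((he a s).add (he (-a) s)).div_const 2 using 1
        field_simp
        ring
      · convert! ((he a s).sub (he (-a) s)).div_const (2 * a) using 1
        field_simp
        ring
      · simp only [chfFactor, h, if_false]
        field_simp
        ring
  have hexp : ∀ s : ℝ, HasDerivAt (fun s : ℝ => Complex.exp (-μ * s))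
      (-μ * Complex.exp (-μ * s)) s := fun s => by
    have := (((hasDerivAt_id s).ofReal_comp).const_mul (-μ : ℂ)).cexp
    simpa [mul_comm] using this
  -- Apart from the damping `-μ`, the system has matrix `K = [[iγ, μ], [μ, -iγ]]` with `K² = a²`, so
  -- `exp (s K) = C + S K`; this is applied to the vector `(1, 1)`.
  refine ⟨fun s => Complex.exp (-μ * s) * (C s + (μ + Complex.I * γ) * S s),
    fun s => Complex.exp (-μ * s) * (C s + (μ - Complex.I * γ) * S s), by simp [hC0, hS0],
    by simp [hC0, hS0], fun s => ?_, fun s => ?_, fun s => ?_⟩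
  · convert! (hexp s).mul ((hC s).add ((hS s).const_mul (μ + Complex.I * γ))) using 1
    simp only [ha, Pi.add_apply]
    linear_combination (Complex.exp (-μ * s) * S s * γ ^ 2) * Complex.I_sq
  · convert! (hexp s).mul ((hC s).add ((hS s).const_mul (μ - Complex.I * γ))) using 1
    simp only [ha, Pi.add_apply]
    linear_combination (Complex.exp (-μ * s) * S s * γ ^ 2) * Complex.I_sq
  · rw [hF]; ring

/-- The velocity `c (α dirX j + β dirY j)` of the phase `α X + β Y` in direction `j`. -/
noncomputable def phaseSpeed (c α β : ℝ) (j : ZMod 4) : ℝ := c * (α * dirX j + β * dirY j)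

theorem sum_zmod_four {M : Type*} [AddCommMonoid M] (f : ZMod 4 → M) :
    ∑ i, f i = f 0 + f 1 + f 2 + f 3 :=
  Fin.sum_univ_four f

theorem forall_zmod_four {q : ZMod 4 → Prop} (h0 : q 0) (h1 : q 1) (h2 : q 2) (h3 : q 3) :
    ∀ i, q i := by
  intro i
  fin_cases i
  exacts [h0, h1, h2, h3]

theorem phaseSpeed_zero (c α β : ℝ) : phaseSpeed c α β 0 = c * α := by
  simp [phaseSpeed, dirX, dirY]

theorem phaseSpeed_one (c α β : ℝ) : phaseSpeed c α β 1 = c * β := by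
  have : (1 : ZMod 4).val = 1 := rfl
  simp [phaseSpeed, dirX, dirY, this]

theorem phaseSpeed_two (c α β : ℝ) : phaseSpeed c α β 2 = -(c * α) := by
  have : (2 : ZMod 4).val = 2 := rfl
  simp [phaseSpeed, dirX, dirY, this]

theorem phaseSpeed_three (c α β : ℝ) : phaseSpeed c α β 3 = -(c * β) := by
  have h3 : (3 : ZMod 4).val = 3 := rfl
  have : Real.pi * 3 / 2 = Real.pi / 2 + Real.pi := by ring
  simp [phaseSpeed, dirX, dirY, h3, this, Real.cos_add_pi, Real.sin_add_pi]

/-- The generator `λ (Π - 1) + i diag (phaseSpeed)` of the Feynman–Kac semigroup of the motion. -/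
noncomputable def phaseGenerator (lam p c α β : ℝ) : Matrix (ZMod 4) (ZMod 4) ℂ :=
  Matrix.diagonal (fun j => Complex.I * phaseSpeed c α β j) + lam • (turnMatrix p - 1)

theorem phaseGenerator_mulVec (lam p c α β : ℝ) (v : ZMod 4 → ℂ) (i : ZMod 4) :
    (phaseGenerator lam p c α β).mulVec v i = Complex.I * phaseSpeed c α β i * v i +
      lam * (∑ j, (turnProb p i j : ℂ) * v j - v i) := by
  rw [phaseGenerator, Matrix.add_mulVec, Matrix.smul_mulVec, Matrix.sub_mulVec]
  simp [Matrix.mulVec_diagonal]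
  left
  simp [Matrix.mulVec, dotProduct, turnMatrix]

theorem complex_sqrt_sq (a : ℂ) : a.sqrt ^ 2 = a :=
  Complex.cpow_nat_inv_pow a two_ne_zero

/-- Only the square of the coefficient enters the telegraph equations, so the branch of the root
plays no role. -/
theorem coefA_sq (lam p c α β : ℝ) :
    coefA lam p c α β ^ 2 = ((lam * p : ℝ) : ℂ) ^ 2 - ((c * (α - β) / 2 : ℝ) : ℂ) ^ 2 := by
  rw [coefA, mul_pow, complex_sqrt_sq]
  push_cast
  ring

theorem coefB_sq (lam p c α β : ℝ) :
    coefB lam p c α β ^ 2 = ((lam * (1 - p) : ℝ) : ℂ) ^ 2 - ((c * (α + β) / 2 : ℝ) : ℂ) ^ 2 := by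
  rw [coefB, mul_pow, complex_sqrt_sq]
  push_cast
  ring

theorem sum_exp_phaseGenerator (lam p c α β t : ℝ) :
    ∑ i, (NormedSpace.exp (t • phaseGenerator lam p c α β)).mulVec 1 i =
      Complex.exp (-lam * t) * chfFactor (lam * p) t (coefA lam p c α β)
        * chfFactor (lam * (1 - p)) t (coefB lam p c α β) := by
  obtain ⟨f, f', hf0, hf'0, hf, hf', hff⟩ := exists_telegraph_solution _ _ _ (coefA_sq lam p c α β)
  obtain ⟨g, g', hg0, hg'0, hg, hg', hgg⟩ := exists_telegraph_solution _ _ _ (coefB_sq lam p c α β)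
  -- `f, f'` stand for the two signs of the velocity of `X - Y`, and `g, g'` for those of `X + Y`;
  -- the primes mark the negative sign, not derivatives.
  let u : ℝ → ZMod 4 → ℂ := fun s =>
    (![f s * g s, f' s * g s, f' s * g' s, f s * g' s] : Fin 4 → ℂ)
  have u0 : ∀ s, u s 0 = f s * g s := fun _ => rfl
  have u1 : ∀ s, u s 1 = f' s * g s := fun _ => rfl
  have u2 : ∀ s, u s 2 = f' s * g' s := fun _ => rfl
  have u3 : ∀ s, u s 3 = f s * g' s := fun _ => rfl
  have hone : u 0 = 1 := by
    funext i
    revert i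
    apply forall_zmod_four <;> simp [u0, u1, u2, u3, hf0, hf'0, hg0, hg'0]
  have hder : ∀ s i, HasDerivAt (fun s => u s i) ((phaseGenerator lam p c α β).mulVec (u s) i) s := by
    intro s
    simp only [phaseGenerator_mulVec, sum_zmod_four]
    apply forall_zmod_four
    · simp only [u0, u1, u2, u3]
      convert! (hf s).mul (hg s) using 1
      simp +decide [turnProb, phaseSpeed_zero]
      ring
    · simp only [u0, u1, u2, u3]
      convert! (hf' s).mul (hg s) using 1
      simp +decide [turnProb, phaseSpeed_one]
      ring
    · simp only [u0, u1, u2, u3]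
      convert! (hf' s).mul (hg' s) using 1
      simp +decide [turnProb, phaseSpeed_two]
      ring
    · simp only [u0, u1, u2, u3]
      convert! (hf s).mul (hg' s) using 1
      simp +decide [turnProb, phaseSpeed_three]
      ring
  rw [← hone, exp_smul_mulVec_of_hasDerivAt hder, sum_zmod_four, u0, u1, u2, u3]
  calc _ = (f t + f' t) * (g t + g' t) := by ring
    _ = _ := by
      rw [hff, hgg, show Complex.exp (-lam * t) =
        Complex.exp (-((lam * p : ℝ) : ℂ) * t) * Complex.exp (-((lam * (1 - p) : ℝ) : ℂ) * t) by
          rw [← Complex.exp_add]; congr 1; push_cast; ring]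
      ring

/-! ### Passage to the limit in the mesh. -/

theorem tendsto_pow_diagonal_mul_exp (lam p c α β t : ℝ) :
    Tendsto (fun n : ℕ => (Matrix.diagonal (fun j => Complex.exp
        (Complex.I * ((t / n * phaseSpeed c α β j : ℝ) : ℂ))) *
      NormedSpace.exp ((lam * (t / n)) • (turnMatrix p - 1))) ^ n) atTop
      (𝓝 (NormedSpace.exp (t • phaseGenerator lam p c α β))) := by
  let D : Matrix (ZMod 4) (ZMod 4) ℂ := Matrix.diagonal fun j => Complex.I * phaseSpeed c α β j
  let T : Matrix (ZMod 4) (ZMod 4) ℂ := lam • (turnMatrix p - 1)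
  have h1 := hasDerivAt_exp_smul_const (𝕂 := ℝ) D 0
  have h2 := hasDerivAt_exp_smul_const (𝕂 := ℝ) T 0
  have h3 : HasDerivAt (fun s : ℝ => NormedSpace.exp (s • D) * NormedSpace.exp (s • T))
      (phaseGenerator lam p c α β) 0 := by
    convert! h1.mul h2 using 1
    simp [phaseGenerator, D, T]
  refine (tendsto_pow_of_hasDerivAt h3 (by simp) t).congr fun n => ?_
  congr 2
  · rw [← Matrix.diagonal_smul, Matrix.exp_diagonal]
    congr 1
    funext j
    rw [Pi.coe_exp, ← Complex.exp_eq_exp_ℂ]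
    congr 1
    simp
    ring
  · rw [smul_smul, mul_comm]

theorem phase_eq_integral {Ω : Type*} {N : ℝ≥0 → Ω → ℕ} (J : ℕ → Ω → ZMod 4) {ω : Ω}
    (hN : Monotone fun t => N t ω) (c α β : ℝ) (t : ℝ≥0) :
    α * posX c N J t ω + β * posY c N J t ω =
      ∫ s in (0 : ℝ)..t, phaseSpeed c α β (direction N J s.toNNReal ω) := by
  have hX := intervalIntegrable_comp_monotone_path hN (fun m => dirX (J m ω)) 1
    (fun m => Real.abs_cos_le_one _) 0 t
  have hY := intervalIntegrable_comp_monotone_path hN (fun m => dirY (J m ω)) 1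
    (fun m => Real.abs_sin_le_one _) 0 t
  simp only [phaseSpeed, intervalIntegral.integral_const_mul, posX, posY, direction]
  rw [intervalIntegral.integral_add (hX.const_mul α) (hY.const_mul β),
    intervalIntegral.integral_const_mul, intervalIntegral.integral_const_mul]
  ring

end MatrixNorm

theorem tendsto_prod_exp_phase {Ω : Type*} {N : ℝ≥0 → Ω → ℕ} (J : ℕ → Ω → ZMod 4) {ω : Ω}
    (hN : Monotone fun t => N t ω) (c α β : ℝ) (t : ℝ≥0) :
    Tendsto (fun n : ℕ => ∏ l ∈ Finset.range n, Complex.exp (Complex.I *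
        ((t / n * phaseSpeed c α β (direction N J (l * (t / n)) ω) : ℝ) : ℂ))) atTop
      (𝓝 (Complex.exp (Complex.I * α * posX c N J t ω + Complex.I * β * posY c N J t ω))) := by
  obtain ⟨M, hM⟩ : ∃ M, ∀ j, ‖phaseSpeed c α β j‖ ≤ M :=
    ⟨∑ j, ‖phaseSpeed c α β j‖, fun j => Finset.single_le_sum
      (f := fun j => ‖phaseSpeed c α β j‖) (fun _ _ => norm_nonneg _) (Finset.mem_univ j)⟩
  have h := tendsto_riemann_sum_monotone_path hN (fun m => phaseSpeed c α β (J m ω)) M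
    (fun _ => hM _) t
  have h2 : ∫ s in (0 : ℝ)..t, phaseSpeed c α β (J (N s.toNNReal ω) ω) =
      α * posX c N J t ω + β * posY c N J t ω := (phase_eq_integral J hN c α β t).symm
  rw [h2] at h
  have h3 := (((Complex.continuous_ofReal.tendsto _).comp h).const_mul Complex.I).cexp
  convert! h3 using 2 with n
  · rw [← Complex.exp_sum]
    simp [Finset.mul_sum, direction]
  · push_cast
    ring_nf

theorem theorem1 {Ω : Type*} [MeasurableSpace Ω] (P : Measure Ω) [IsProbabilityMeasure P]
    (lam : ℝ≥0) (hlam : 0 < lam) (c : ℝ) (hc : 0 < c) (p : ℝ) (hp0 : 0 < p) (hp1 : p < 1)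
    (N : ℝ≥0 → Ω → ℕ) (J : ℕ → Ω → ZMod 4) (h : IsOrthogonalMotion lam p N J P)
    (t : ℝ≥0) (α β : ℝ) :
    Integrable
      (fun ω => Complex.exp (Complex.I * α * posX c N J t ω + Complex.I * β * posY c N J t ω)) P ∧
    ∫ ω, Complex.exp (Complex.I * α * posX c N J t ω + Complex.I * β * posY c N J t ω) ∂P =
      Complex.exp (-(lam : ℝ) * (t : ℝ)) / 4
        * chfFactor (lam * p) t (coefA lam p c α β)
        * chfFactor (lam * (1 - p)) t (coefB lam p c α β) := by
  let φ : ℕ → ZMod 4 → ℂ := fun n j =>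
    Complex.exp (Complex.I * ((t / n * phaseSpeed c α β j : ℝ) : ℂ))
  have hφ : ∀ n j, ‖φ n j‖ ≤ 1 := fun n j => (Complex.norm_exp_I_mul_ofReal _).le
  have hdir : ∀ s, Measurable (direction N J s) := fun s => by
    have : Measurable fun x : ℕ × Ω => J x.1 x.2 :=
      measurable_from_prod_countable_right h.chain.measurable
    exact this.comp (g := fun x : ℕ × Ω => J x.1 x.2) (f := fun ω => (N s ω, ω))
      ((h.poisson.measurable s).prodMk measurable_id)
  have hmeas : ∀ n : ℕ, AEStronglyMeasurable
      (fun ω => ∏ l ∈ Finset.range n, φ n (direction N J (l * (t / n)) ω)) P := fun n =>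
    (Finset.measurable_prod _ fun l _ =>
      (Measurable.of_discrete (f := φ n)).comp (hdir _)).aestronglyMeasurable
  have hlim : ∀ᵐ ω ∂P, Tendsto
      (fun n : ℕ => ∏ l ∈ Finset.range n, φ n (direction N J (l * (t / n)) ω)) atTop
      (𝓝 (Complex.exp (Complex.I * α * posX c N J t ω + Complex.I * β * posY c N J t ω))) := by
    filter_upwards [h.poisson.monotone] with ω hN
    exact tendsto_prod_exp_phase J hN c α β t
  -- Measurability of the position variable is inherited from the discrete products, as their almost
  -- sure limit.
  refine ⟨Integrable.of_bound (aestronglyMeasurable_of_tendsto_ae atTop hmeas hlim) 1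
    (Eventually.of_forall fun ω => ?_), ?_⟩
  · rw [show Complex.I * α * posX c N J t ω + Complex.I * β * posY c N J t ω =
      Complex.I * ((α * posX c N J t ω + β * posY c N J t ω : ℝ) : ℂ) by push_cast; ring]
    exact (Complex.norm_exp_I_mul_ofReal _).le
  · have hI := tendsto_integral_of_dominated_convergence (fun _ => (1 : ℝ)) hmeas
      (integrable_const _) (fun n => Eventually.of_forall fun ω => by
        rw [norm_prod]
        exact Finset.prod_le_one (fun _ _ => norm_nonneg _) fun _ _ => hφ _ _) hlim
    simp_rw [h.integral_prod_direction (φ _) (hφ _)] at hI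
    have hcont : Continuous fun M : Matrix (ZMod 4) (ZMod 4) ℂ => 1 / 4 * ∑ i, M.mulVec 1 i := by
      simp only [Matrix.mulVec, dotProduct]
      fun_prop
    have hS := (hcont.tendsto _).comp (tendsto_pow_diagonal_mul_exp lam p c α β t)
    rw [sum_exp_phaseGenerator] at hS
    refine (tendsto_nhds_unique hI (hS.congr fun n => ?_)).trans (by ring)
    simp [φ]
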